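/- Let $\mathbb D$ be the open unit disk and let $L^2_a$ be the Bergman space, i.e. the Hilbert space of holomorphic functions on $\mathbb D$ that are square-integrable with respect to area measure. For a bounded linear operator $A$ on a complex Hilbert space $H$, let $\mathrm{Ext}(A)$ be the set of all $\lambda\in\mathbb C$ for which there is a nonzero bounded linear operator $X$ on $H$ with $AX=\lambda XA$. **Theorem.** Let $a\in\mathbb C$ with $\operatorname{Re} a=0$ and $a\neq 0$, and let $$\varphi(z)=\frac{(2-a)z+a}{-az+2+a}$$ (a parabolic automorphism of $\mathbb D$). Then the composition operator $C_\varphi f=f\circ\varphi$ is a well-defined bounded operator on $L^2_a$, and $$\mathrm{Ext}(C_\varphi)=\partial\mathbb D=\{\lambda\in\mathbb C:|\lambda|=1\}.$$ -/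

import Mathlib

open MeasureTheory

/-- Area measure on the open unit disk of the complex plane. -/
noncomputable def diskArea : Measure ℂ := volume.restrict (Metric.ball (0 : ℂ) 1)

/-- `g` is a holomorphic representative, on the open unit disk, of the class `f ∈ L²(𝔻, dA)`. -/
def IsHolomorphicRep (f : Lp ℂ 2 diskArea) (g : ℂ → ℂ) : Prop :=
  DifferentiableOn ℂ g (Metric.ball 0 1) ∧ f =ᵐ[diskArea] g

/-- The Bergman space `L²_a`: the square-integrable holomorphic functions on the unit disk, as a
subspace of `L²(𝔻, dA)` with the inherited inner product. -/
noncomputable def BergmanSpace : Submodule ℂ (Lp ℂ 2 diskArea) where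
  carrier := {f | ∃ g : ℂ → ℂ, IsHolomorphicRep f g}
  zero_mem' := ⟨0, differentiableOn_const 0, Lp.coeFn_zero _ _ _⟩
  add_mem' := by
    rintro f₁ f₂ ⟨g₁, h₁, e₁⟩ ⟨g₂, h₂, e₂⟩
    exact ⟨g₁ + g₂, h₁.add h₂, (Lp.coeFn_add f₁ f₂).trans (e₁.add e₂)⟩
  smul_mem' := by
    rintro c f ⟨g, h, e⟩
    exact ⟨c • g, h.const_smul c, (Lp.coeFn_smul c f).trans (e.const_smul c)⟩

/-- The bounded operator `C` on `L²_a` is the composition operator `C_φ f = f ∘ φ`. The composition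
is taken with the holomorphic representative of `f`, which is unique on the disk. -/
def IsCompositionOperator (φ : ℂ → ℂ) (C : BergmanSpace →L[ℂ] BergmanSpace) : Prop :=
  ∀ (f : BergmanSpace) (g : ℂ → ℂ), IsHolomorphicRep (f : Lp ℂ 2 diskArea) g →
    IsHolomorphicRep (C f : Lp ℂ 2 diskArea) (g ∘ φ)

/-- The extended spectrum `Ext(A)`: all `c ∈ ℂ` for which `A X = c X A` has a nonzero bounded
solution `X`. -/
def extendedSpectrum {H : Type*} [NormedAddCommGroup H] [InnerProductSpace ℂ H]
    (A : H →L[ℂ] H) : Set ℂ :=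
  {c | ∃ X : H →L[ℂ] H, X ≠ 0 ∧ A ∘L X = c • (X ∘L A)}

/-- The linear fractional map `z ↦ ((2 - a) z + a) / (-a z + 2 + a)`. -/
noncomputable def parabolicMap (a : ℂ) (z : ℂ) : ℂ :=
  ((2 - a) * z + a) / (-a * z + 2 + a)

open Metric

/-! In the half-plane coordinate `w = (1 + z) / (1 - z)` the map `parabolicMap b` is the translation
`w ↦ w + b`. Hence the powers of `C` and their inverses have symbols `parabolicMap (± n a)`, and a
change of variables bounds their norms by `(1 + n‖a‖) ^ 2`. If `C X = c X C`, then `C ^ n X = c ^ n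
X C ^ n`; polynomial growth on both sides rules out `‖c‖ < 1` and `‖c‖ > 1`
(`norm_eq_one_of_mem_extendedSpectrum`). Conversely `exp (-s w)`, `s ≥ 0`, is bounded on the disk
and is multiplied by `exp (-s a)` under the translation, so multiplication by it is a solution `X`
for `c = exp (-s a)`; as `a` is imaginary and nonzero, these values fill the circle
(`exp_mem_extendedSpectrum`). -/

/-! ### Holomorphic representatives and operators on the Bergman space. -/

theorem IsHolomorphicRep.eqOn {f : Lp ℂ 2 diskArea} {g₁ g₂ : ℂ → ℂ}
    (h₁ : IsHolomorphicRep f g₁) (h₂ : IsHolomorphicRep f g₂) :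
    Set.EqOn g₁ g₂ (ball 0 1) :=
  Measure.eqOn_open_of_ae_eq (h₁.2.symm.trans h₂.2) isOpen_ball h₁.1.continuousOn
    h₂.1.continuousOn

theorem ae_diskArea_of_forall_mem_ball {p : ℂ → Prop} (h : ∀ z ∈ ball (0 : ℂ) 1, p z) :
    ∀ᵐ z ∂diskArea, p z :=
  (ae_restrict_iff' measurableSet_ball).2 (Filter.Eventually.of_forall h)

theorem IsHolomorphicRep.congr {f : Lp ℂ 2 diskArea} {g₁ g₂ : ℂ → ℂ}
    (h : IsHolomorphicRep f g₁) (hg : Set.EqOn g₁ g₂ (ball 0 1)) : IsHolomorphicRep f g₂ :=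
  ⟨h.1.congr hg.symm, h.2.trans (ae_diskArea_of_forall_mem_ball hg)⟩

theorem IsHolomorphicRep.unique {f₁ f₂ : BergmanSpace} {g : ℂ → ℂ}
    (h₁ : IsHolomorphicRep (f₁ : Lp ℂ 2 diskArea) g)
    (h₂ : IsHolomorphicRep (f₂ : Lp ℂ 2 diskArea) g) : f₁ = f₂ :=
  Subtype.ext (Lp.ext (h₁.2.trans h₂.2.symm))

theorem IsHolomorphicRep.add {f₁ f₂ : Lp ℂ 2 diskArea} {g₁ g₂ : ℂ → ℂ}
    (h₁ : IsHolomorphicRep f₁ g₁) (h₂ : IsHolomorphicRep f₂ g₂) :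
    IsHolomorphicRep (f₁ + f₂) (g₁ + g₂) :=
  ⟨h₁.1.add h₂.1, (Lp.coeFn_add f₁ f₂).trans (h₁.2.add h₂.2)⟩

theorem IsHolomorphicRep.const_smul (c : ℂ) {f : Lp ℂ 2 diskArea} {g : ℂ → ℂ}
    (h : IsHolomorphicRep f g) : IsHolomorphicRep (c • f) (c • g) :=
  ⟨h.1.const_smul c, (Lp.coeFn_smul c f).trans (h.2.const_smul c)⟩

theorem IsHolomorphicRep.memLp {f : Lp ℂ 2 diskArea} {g : ℂ → ℂ}
    (h : IsHolomorphicRep f g) : MemLp g 2 diskArea :=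
  (memLp_congr_ae h.2).1 (Lp.memLp f)

/-- A linear transformation of functions that preserves holomorphy on the disk and is bounded for
the `L²` seminorm induces a bounded operator on the Bergman space. -/
theorem exists_bergman_operator (Φ : (ℂ → ℂ) →ₗ[ℂ] (ℂ → ℂ)) (K : NNReal)
    (hd : ∀ g, DifferentiableOn ℂ g (ball 0 1) → DifferentiableOn ℂ (Φ g) (ball 0 1))
    (hK : ∀ g, DifferentiableOn ℂ g (ball 0 1) →
      eLpNorm (Φ g) 2 diskArea ≤ K * eLpNorm g 2 diskArea) :
    ∃ T : BergmanSpace →L[ℂ] BergmanSpace, ‖T‖ ≤ K ∧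
      ∀ (f : BergmanSpace) (g : ℂ → ℂ), IsHolomorphicRep (f : Lp ℂ 2 diskArea) g →
        IsHolomorphicRep (T f : Lp ℂ 2 diskArea) (Φ g) := by
  have key : ∀ f : BergmanSpace, ∃ F : BergmanSpace,
      ∀ g : ℂ → ℂ, IsHolomorphicRep (f : Lp ℂ 2 diskArea) g →
        IsHolomorphicRep (F : Lp ℂ 2 diskArea) (Φ g) := by
    intro f
    obtain ⟨g, hg⟩ := f.2
    have hΦ : MemLp (Φ g) 2 diskArea :=
      ⟨(hd g hg.1).continuousOn.aestronglyMeasurable measurableSet_ball,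
        (hK g hg.1).trans_lt (ENNReal.mul_lt_top ENNReal.coe_lt_top hg.memLp.2)⟩
    refine ⟨⟨hΦ.toLp _, Φ g, hd g hg.1, hΦ.coeFn_toLp⟩, fun g' hg' => ⟨hd g' hg'.1, ?_⟩⟩
    refine hΦ.coeFn_toLp.trans ?_
    -- Representatives may differ off the disk, where `Φ` could look; the norm bound applied to `g -
    -- g'` shows that this does not matter.
    have h0 : eLpNorm (g - g') 2 diskArea = 0 := by
      rw [eLpNorm_congr_ae (g := 0), eLpNorm_zero]
      exact ae_diskArea_of_forall_mem_ball fun z hz => by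
        simp [hg.eqOn hg' hz]
    have h1 : eLpNorm (Φ (g - g')) 2 diskArea = 0 := by
      have := hK (g - g') (hg.1.sub hg'.1)
      simpa [h0] using this
    have hm : AEStronglyMeasurable (Φ (g - g')) diskArea :=
      (hd _ (hg.1.sub hg'.1)).continuousOn.aestronglyMeasurable measurableSet_ball
    filter_upwards [(eLpNorm_eq_zero_iff hm two_ne_zero).1 h1] with z hz
    rw [map_sub] at hz
    exact sub_eq_zero.1 hz
  choose T hT using key
  have hrep : ∀ f : BergmanSpace, ∃ g, IsHolomorphicRep (f : Lp ℂ 2 diskArea) g := fun f => f.2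
  let L : BergmanSpace →ₗ[ℂ] BergmanSpace :=
    { toFun := T
      map_add' := fun f₁ f₂ => by
        obtain ⟨g₁, h₁⟩ := hrep f₁
        obtain ⟨g₂, h₂⟩ := hrep f₂
        refine (hT (f₁ + f₂) _ (h₁.add h₂)).unique ?_
        rw [map_add]
        exact (hT f₁ g₁ h₁).add (hT f₂ g₂ h₂)
      map_smul' := fun c f => by
        obtain ⟨g, h⟩ := hrep f
        refine (hT (c • f) _ (h.const_smul c)).unique ?_
        rw [map_smul]
        exact (hT f g h).const_smul c }
  refine ⟨L.mkContinuous K fun f => ?_, LinearMap.mkContinuous_norm_le _ K.2 _, hT⟩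
  obtain ⟨g, hg⟩ := hrep f
  change ‖(T f : Lp ℂ 2 diskArea)‖ ≤ K * ‖(f : Lp ℂ 2 diskArea)‖
  rw [Lp.norm_def, Lp.norm_def, eLpNorm_congr_ae (hT f g hg).2, eLpNorm_congr_ae hg.2,
    ← ENNReal.coe_toReal, ← ENNReal.toReal_mul]
  exact ENNReal.toReal_mono
    (ENNReal.mul_lt_top ENNReal.coe_lt_top hg.memLp.2).ne (hK g hg.1)

/-! ### The parabolic group of disk automorphisms. -/

theorem parabolicMap_denom_ne_zero {b z : ℂ} (hb : b.re = 0) (hz : z ∈ ball (0 : ℂ) 1) :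
    -b * z + 2 + b ≠ 0 := by
  have hz' : z.re ^ 2 + z.im ^ 2 < 1 := by
    rw [mem_ball_zero_iff] at hz
    have h1 : ‖z‖ ^ 2 < 1 := by nlinarith [norm_nonneg z]
    rw [← Complex.normSq_eq_norm_sq, Complex.normSq_apply] at h1
    linarith
  intro h
  have hr := congrArg Complex.re h
  have hi := congrArg Complex.im h
  simp [hb] at hr hi
  have h2 : b.im * (1 - z.re) = 0 := by linarith
  rcases mul_eq_zero.1 h2 with h3 | h3
  · simp [h3] at hr
  · nlinarith [sq_nonneg z.im]

theorem parabolicMap_mem_ball {b z : ℂ} (hb : b.re = 0) (hz : z ∈ ball (0 : ℂ) 1) :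
    parabolicMap b z ∈ ball (0 : ℂ) 1 := by
  have h0 := parabolicMap_denom_ne_zero hb hz
  rw [mem_ball_zero_iff] at hz ⊢
  have h1 : ‖z‖ ^ 2 < 1 := by nlinarith [norm_nonneg z]
  rw [← Complex.normSq_eq_norm_sq, Complex.normSq_apply] at h1
  rw [parabolicMap, norm_div, div_lt_one (norm_pos_iff.2 h0)]
  refine lt_of_pow_lt_pow_left₀ 2 (norm_nonneg _) ?_
  rw [← Complex.normSq_eq_norm_sq, ← Complex.normSq_eq_norm_sq, Complex.normSq_apply,
    Complex.normSq_apply]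
  simp [hb]
  -- The squared moduli of denominator and numerator differ by `4 (1 - |z|²)`.
  nlinarith

theorem hasDerivAt_parabolicMap {b z : ℂ} (hb : b.re = 0) (hz : z ∈ ball (0 : ℂ) 1) :
    HasDerivAt (parabolicMap b) (4 / (-b * z + 2 + b) ^ 2) z := by
  have h0 := parabolicMap_denom_ne_zero hb hz
  have h1 : HasDerivAt (fun z : ℂ => (2 - b) * z + b) (2 - b) z := by
    simpa using ((hasDerivAt_id z).const_mul (2 - b)).add_const b
  have h2 : HasDerivAt (fun z : ℂ => -b * z + 2 + b) (-b) z := by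
    simpa using (((hasDerivAt_id z).const_mul (-b)).add_const 2).add_const b
  refine (h1.div h2 h0).congr_deriv ?_
  rw [div_left_inj' (pow_ne_zero 2 h0)]
  ring

theorem parabolicMap_parabolicMap {b c z : ℂ} (hb : b.re = 0) (hc : c.re = 0)
    (hz : z ∈ ball (0 : ℂ) 1) :
    parabolicMap b (parabolicMap c z) = parabolicMap (b + c) z := by
  have h1 := parabolicMap_denom_ne_zero hc hz
  have h2 := parabolicMap_denom_ne_zero hb (parabolicMap_mem_ball hc hz)
  have h3 := parabolicMap_denom_ne_zero (b := b + c) (by simp [hb, hc]) hz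
  unfold parabolicMap at h2 ⊢
  rw [div_eq_div_iff h2 h3]
  generalize hD : -c * z + 2 + c = D at h1
  field_simp
  rw [← hD]
  ring

theorem parabolicMap_zero (z : ℂ) : parabolicMap 0 z = z := by
  simp [parabolicMap]

theorem parabolicMap_neg_cancel {b z : ℂ} (hb : b.re = 0) (hz : z ∈ ball (0 : ℂ) 1) :
    parabolicMap (-b) (parabolicMap b z) = z := by
  rw [parabolicMap_parabolicMap (by simp [hb]) hb hz, neg_add_cancel, parabolicMap_zero]

theorem parabolicMap_image_ball {b : ℂ} (hb : b.re = 0) :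
    parabolicMap b '' ball 0 1 = ball 0 1 := by
  refine Set.Subset.antisymm (Set.image_subset_iff.2 fun z => parabolicMap_mem_ball hb) ?_
  intro z hz
  have hb' : (-b).re = 0 := by simp [hb]
  exact ⟨parabolicMap (-b) z, parabolicMap_mem_ball hb' hz,
    by simpa using parabolicMap_neg_cancel hb' hz⟩

theorem parabolicMap_injOn {b : ℂ} (hb : b.re = 0) :
    Set.InjOn (parabolicMap b) (ball 0 1) :=
  Set.LeftInvOn.injOn (f₁' := parabolicMap (-b)) fun _ => parabolicMap_neg_cancel hb

theorem Complex.det_smul_one (c : ℂ) :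
    (c • (1 : ℂ →L[ℝ] ℂ)).det = Complex.normSq c := by
  rw [← Algebra.norm_complex_apply, Algebra.norm_apply, ContinuousLinearMap.det]
  congr 1

/-- The Jacobian is `16 / |-b z + 2 + b| ^ 4`, and the denominator is at most `2 (1 + ‖b‖)` in
modulus, so the Jacobian is at least `(1 + ‖b‖) ^ (-4)`. -/
theorem eLpNorm_comp_parabolicMap_le {b : ℂ} (hb : b.re = 0) (g : ℂ → ℂ) :
    eLpNorm (g ∘ parabolicMap b) 2 diskArea ≤
      ((1 + ‖b‖₊) ^ 2 : NNReal) * eLpNorm g 2 diskArea := by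
  have hcv := lintegral_image_eq_lintegral_abs_det_fderiv_mul volume
    (measurableSet_ball (x := (0 : ℂ)) (ε := 1))
    (fun z hz => ((hasDerivAt_parabolicMap hb hz).complexToReal_fderiv).hasFDerivWithinAt)
    (parabolicMap_injOn hb) (fun z => ‖g z‖ₑ ^ (2 : ℝ))
  rw [parabolicMap_image_ball hb] at hcv
  have hint : ∫⁻ z, ‖(g ∘ parabolicMap b) z‖ₑ ^ (2 : ℝ) ∂diskArea ≤
      (((1 + ‖b‖₊) ^ 2 : NNReal) : ENNReal) ^ (2 : ℝ) * ∫⁻ z, ‖g z‖ₑ ^ (2 : ℝ) ∂diskArea := by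
    unfold diskArea
    rw [hcv, ← lintegral_const_mul' _ _ (by simp [← ENNReal.coe_pow])]
    refine setLIntegral_mono' measurableSet_ball fun z hz => ?_
    rw [← mul_assoc]
    refine le_mul_of_one_le_left' ?_
    rw [Complex.det_smul_one]
    have h0 := parabolicMap_denom_ne_zero hb hz
    rw [mem_ball_zero_iff] at hz
    have hle : ‖-b * z + 2 + b‖ ≤ 2 * (1 + ‖b‖) := by
      calc ‖-b * z + 2 + b‖ ≤ ‖-b * z‖ + ‖(2 : ℂ)‖ + ‖b‖ := norm_add₃_le
        _ ≤ 2 * (1 + ‖b‖) := by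
          rw [norm_mul, norm_neg, Complex.norm_two]
          nlinarith [norm_nonneg b]
    have hpos : 0 < ‖-b * z + 2 + b‖ := norm_pos_iff.2 h0
    have hC : (((1 + ‖b‖₊) ^ 2 : NNReal) : ENNReal) ^ (2 : ℝ) =
        ENNReal.ofReal ((1 + ‖b‖) ^ 4) := by
      rw [show (2 : ℝ) = ((2 : ℕ) : ℝ) by norm_num, ENNReal.rpow_natCast, ← ENNReal.coe_pow,
        ENNReal.ofReal, ← pow_mul]
      congr 1
      ext
      rw [Real.coe_toNNReal _ (by positivity)]
      simp
    rw [hC, ← ENNReal.ofReal_mul (by positivity), ← ENNReal.ofReal_one]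
    refine ENNReal.ofReal_le_ofReal ?_
    rw [abs_of_nonneg (Complex.normSq_nonneg _), Complex.normSq_eq_norm_sq, norm_div, norm_pow,
      div_pow, mul_div_assoc', le_div_iff₀ (by positivity), one_mul, ← pow_mul]
    calc ‖-b * z + 2 + b‖ ^ (2 * 2) ≤ (2 * (1 + ‖b‖)) ^ (2 * 2) := by gcongr
      _ = (1 + ‖b‖) ^ 4 * ‖(4 : ℂ)‖ ^ 2 := by
        rw [show ‖(4 : ℂ)‖ = 4 by norm_num]
        ring
  rw [eLpNorm_eq_lintegral_rpow_enorm_toReal (by norm_num) (by norm_num),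
    eLpNorm_eq_lintegral_rpow_enorm_toReal (by norm_num) (by norm_num)]
  simp only [ENNReal.toReal_ofNat]
  refine (ENNReal.rpow_le_rpow hint (by norm_num)).trans_eq ?_
  rw [ENNReal.mul_rpow_of_nonneg _ _ (by norm_num), ← ENNReal.rpow_mul]
  norm_num

/-! ### Composition operators and their powers. -/

theorem exists_isCompositionOperator_parabolicMap {b : ℂ} (hb : b.re = 0) :
    ∃ T : BergmanSpace →L[ℂ] BergmanSpace,
      ‖T‖ ≤ (1 + ‖b‖) ^ 2 ∧ IsCompositionOperator (parabolicMap b) T := by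
  obtain ⟨T, hT, hrep⟩ := exists_bergman_operator (LinearMap.funLeft ℂ ℂ (parabolicMap b))
    ((1 + ‖b‖₊) ^ 2)
    (fun g hg => hg.comp
      (fun z hz => (hasDerivAt_parabolicMap hb hz).differentiableAt.differentiableWithinAt)
      fun z => parabolicMap_mem_ball hb)
    (fun g _ => eLpNorm_comp_parabolicMap_le hb g)
  exact ⟨T, by simpa using hT, hrep⟩

theorem IsCompositionOperator.unique {φ : ℂ → ℂ} {C D : BergmanSpace →L[ℂ] BergmanSpace}
    (hC : IsCompositionOperator φ C) (hD : IsCompositionOperator φ D) : C = D := by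
  ext1 f
  obtain ⟨g, hg⟩ := f.2
  exact (hC f g hg).unique (hD f g hg)

theorem IsCompositionOperator.comp {φ ψ : ℂ → ℂ} {C D : BergmanSpace →L[ℂ] BergmanSpace}
    (hC : IsCompositionOperator φ C) (hD : IsCompositionOperator ψ D) :
    IsCompositionOperator (φ ∘ ψ) (D ∘L C) :=
  fun f g hg => hD (C f) (g ∘ φ) (hC f g hg)

theorem IsCompositionOperator.congr {φ ψ : ℂ → ℂ} {C : BergmanSpace →L[ℂ] BergmanSpace}
    (hC : IsCompositionOperator φ C) (h : Set.EqOn φ ψ (ball 0 1)) :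
    IsCompositionOperator ψ C :=
  fun f g hg => (hC f g hg).congr fun _ hz => congrArg g (h hz)

theorem isCompositionOperator_id :
    IsCompositionOperator id (ContinuousLinearMap.id ℂ BergmanSpace) :=
  fun _ _ hg => hg

theorem IsCompositionOperator.pow_parabolicMap {a : ℂ} (ha : a.re = 0)
    {C : BergmanSpace →L[ℂ] BergmanSpace} (hC : IsCompositionOperator (parabolicMap a) C)
    (n : ℕ) : IsCompositionOperator (parabolicMap (n * a)) (C ^ n) := by
  induction n with
  | zero =>
    refine isCompositionOperator_id.congr fun _ _ => ?_
    simp [parabolicMap_zero]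
  | succ n ih =>
    rw [pow_succ]
    refine (hC.comp ih).congr fun z hz => ?_
    rw [Function.comp_apply, parabolicMap_parabolicMap ha (by simp [ha]) hz]
    push_cast
    ring_nf

theorem IsCompositionOperator.exists_inverse_pow {a : ℂ} (ha : a.re = 0)
    {C : BergmanSpace →L[ℂ] BergmanSpace} (hC : IsCompositionOperator (parabolicMap a) C)
    (n : ℕ) : ∃ D : BergmanSpace →L[ℂ] BergmanSpace, D * C ^ n = 1 ∧ C ^ n * D = 1 ∧
      ‖C ^ n‖ ≤ (1 + n * ‖a‖) ^ 2 ∧ ‖D‖ ≤ (1 + n * ‖a‖) ^ 2 := by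
  have hb : ((n : ℂ) * a).re = 0 := by simp [ha]
  have hb' : (-((n : ℂ) * a)).re = 0 := by rw [Complex.neg_re, hb, neg_zero]
  have hCn := hC.pow_parabolicMap ha n
  obtain ⟨T, hT, hTc⟩ := exists_isCompositionOperator_parabolicMap hb
  obtain ⟨D, hD, hDc⟩ := exists_isCompositionOperator_parabolicMap hb'
  -- The symbol determines the operator, so the norm bound passes from `T` to `C ^ n`.
  rw [← hCn.unique hTc] at hT
  refine ⟨D, ?_, ?_, by simpa using hT, by simpa using hD⟩
  · refine ((hCn.comp hDc).congr fun z hz => ?_).unique isCompositionOperator_id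
    simpa using parabolicMap_neg_cancel hb' hz
  · refine ((hDc.comp hCn).congr fun z hz => ?_).unique isCompositionOperator_id
    exact parabolicMap_neg_cancel hb hz

/-! ### The extended spectrum lies on the circle. -/

/-- Geometric decay beats polynomial growth. -/
theorem one_le_of_one_le_pow_mul_pow {r M : ℝ} (hr : 0 ≤ r) (k : ℕ)
    (h : ∀ n : ℕ, 1 ≤ n → 1 ≤ r ^ n * (n * M) ^ k) : 1 ≤ r := by
  by_contra! hlt
  have hlim := (tendsto_pow_const_mul_const_pow_of_abs_lt_one k
    (by rwa [abs_of_nonneg hr])).const_mul (M ^ k)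
  rw [mul_zero] at hlim
  have : (1 : ℝ) ≤ 0 := ge_of_tendsto hlim <| by
    filter_upwards [Filter.eventually_ge_atTop 1] with n hn
    refine (h n hn).trans_eq ?_
    rw [mul_pow]
    ring
  linarith

theorem pow_mul_eq_of_intertwines {A : Type*} [Ring A] [Algebra ℂ A] {C X : A} {c : ℂ}
    (h : C * X = c • (X * C)) (n : ℕ) : C ^ n * X = c ^ n • (X * C ^ n) := by
  induction n with
  | zero => simp
  | succ n ih =>
    rw [pow_succ, mul_assoc, h, mul_smul_comm, ← mul_assoc, ih, smul_mul_assoc, smul_smul,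
      mul_assoc, ← pow_succ']

/-- If the powers of `C` and of its inverse grow polynomially, then `Ext(C)` lies on the unit
circle. -/
theorem norm_eq_one_of_mem_extendedSpectrum {H : Type*} [NormedAddCommGroup H]
    [InnerProductSpace ℂ H] {C : H →L[ℂ] H} {m : ℝ} (hm : 0 ≤ m)
    (hC : ∀ n : ℕ, ∃ D : H →L[ℂ] H, D * C ^ n = 1 ∧ C ^ n * D = 1 ∧
      ‖C ^ n‖ ≤ (1 + n * m) ^ 2 ∧ ‖D‖ ≤ (1 + n * m) ^ 2)
    {c : ℂ} (hc : c ∈ extendedSpectrum C) : ‖c‖ = 1 := by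
  obtain ⟨X, hX0, hX⟩ := hc
  have hXpos : 0 < ‖X‖ := norm_pos_iff.2 hX0
  have hpoly : ∀ n : ℕ, 1 ≤ n → (1 + n * m) ^ 2 * (1 + n * m) ^ 2 ≤
      (n * (1 + m)) ^ 4 := by
    intro n hn
    have hn' : (1 : ℝ) ≤ n := by exact_mod_cast hn
    rw [← pow_add]
    gcongr
    linarith
  have hconj : ∀ (n : ℕ) (P Q : H →L[ℂ] H), 1 ≤ n →
      ‖P‖ ≤ (1 + n * m) ^ 2 → ‖Q‖ ≤ (1 + n * m) ^ 2 →
      ‖P * X * Q‖ ≤ (n * (1 + m)) ^ 4 * ‖X‖ := by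
    intro n P Q hn hP hQ
    calc ‖P * X * Q‖ ≤ ‖P‖ * ‖X‖ * ‖Q‖ :=
          (norm_mul_le _ _).trans (mul_le_mul_of_nonneg_right (norm_mul_le _ _) (norm_nonneg _))
      _ = ‖P‖ * ‖Q‖ * ‖X‖ := by ring
      _ ≤ (1 + n * m) ^ 2 * (1 + n * m) ^ 2 * ‖X‖ := by gcongr
      _ ≤ _ := by
        gcongr
        exact hpoly n hn
  have hlower : 1 ≤ ‖c‖ := by
    refine one_le_of_one_le_pow_mul_pow (norm_nonneg c) 4 (M := 1 + m) fun n hn => ?_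
    obtain ⟨D, hDC, -, hCn, hDn⟩ := hC n
    -- Conjugating by `C ^ n` recovers `X` up to the factor `c ^ n`.
    have hXe : X = c ^ n • (D * X * C ^ n) := by
      rw [mul_assoc, ← mul_smul_comm, ← pow_mul_eq_of_intertwines hX, ← mul_assoc, hDC, one_mul]
    have h1 : ‖X‖ ≤ ‖c‖ ^ n * ((n * (1 + m)) ^ 4 * ‖X‖) := by
      conv_lhs => rw [hXe, norm_smul, norm_pow]
      gcongr
      exact hconj n D (C ^ n) hn hDn hCn
    rw [← mul_assoc] at h1
    exact le_of_mul_le_mul_right (by rwa [one_mul]) hXpos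
  refine le_antisymm ?_ hlower
  have hcpos : 0 < ‖c‖ := by linarith
  -- The same growth argument, now for `‖c‖⁻¹`, with the roles of `C ^ n` and its inverse exchanged.
  rw [← inv_inv ‖c‖]
  refine inv_le_one_of_one_le₀ ?_
  refine one_le_of_one_le_pow_mul_pow (by positivity) 4 (M := 1 + m) fun n hn => ?_
  obtain ⟨D, -, hCD, hCn, hDn⟩ := hC n
  have hXe : c ^ n • X = C ^ n * X * D := by
    rw [pow_mul_eq_of_intertwines hX, smul_mul_assoc, mul_assoc, hCD, mul_one]
  have h1 : ‖c‖ ^ n * ‖X‖ ≤ (n * (1 + m)) ^ 4 * ‖X‖ := by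
    rw [← norm_pow, ← norm_smul, hXe]
    exact hconj n (C ^ n) D hn hCn hDn
  have h2 := le_of_mul_le_mul_right h1 hXpos
  rw [inv_pow, ← div_eq_inv_mul, le_div_iff₀ (by positivity), one_mul]
  exact h2

/-! ### Every point of the circle is attained. -/

/-- The singular inner function `exp (-s (1 + z) / (1 - z))`. -/
noncomputable def singularInner (s : ℝ) (z : ℂ) : ℂ :=
  Complex.exp (-s * ((1 + z) / (1 - z)))

theorem one_sub_ne_zero_of_mem_ball {z : ℂ} (hz : z ∈ ball (0 : ℂ) 1) : 1 - z ≠ 0 := by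
  intro h
  rw [← sub_eq_zero.1 h] at hz
  simp at hz

theorem differentiableOn_singularInner (s : ℝ) :
    DifferentiableOn ℂ (singularInner s) (ball 0 1) := by
  intro z hz
  have h := one_sub_ne_zero_of_mem_ball hz
  unfold singularInner
  refine DifferentiableAt.differentiableWithinAt ?_
  fun_prop (disch := assumption)

/-- The real part of `(1 + z) / (1 - z)` is `(1 - |z|²) / |1 - z|²`, which is positive on the disk.
-/
theorem norm_singularInner_le_one {s : ℝ} (hs : 0 ≤ s) {z : ℂ} (hz : z ∈ ball (0 : ℂ) 1) :
    ‖singularInner s z‖ ≤ 1 := by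
  have hne := one_sub_ne_zero_of_mem_ball hz
  rw [singularInner, Complex.norm_exp, Real.exp_le_one_iff, ← Complex.ofReal_neg,
    Complex.re_ofReal_mul, neg_mul, neg_nonpos]
  refine mul_nonneg hs ?_
  rw [mem_ball_zero_iff] at hz
  have h1 : ‖z‖ ^ 2 < 1 := by nlinarith [norm_nonneg z]
  rw [← Complex.normSq_eq_norm_sq, Complex.normSq_apply] at h1
  rw [Complex.div_re, ← add_div]
  refine div_nonneg ?_ (Complex.normSq_nonneg _)
  simp
  nlinarith

theorem singularInner_parabolicMap (s : ℝ) {a z : ℂ} (ha : a.re = 0)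
    (hz : z ∈ ball (0 : ℂ) 1) :
    singularInner s (parabolicMap a z) = Complex.exp (-s * a) * singularInner s z := by
  have h1 := one_sub_ne_zero_of_mem_ball hz
  have h2 := parabolicMap_denom_ne_zero ha hz
  have h3 := one_sub_ne_zero_of_mem_ball (parabolicMap_mem_ball ha hz)
  have hw : (1 + parabolicMap a z) / (1 - parabolicMap a z) = a + (1 + z) / (1 - z) := by
    rw [div_eq_iff h3, parabolicMap]
    generalize hD : -a * z + 2 + a = D at h2
    field_simp
    rw [← hD]
    ring
  rw [singularInner, singularInner, hw, ← Complex.exp_add, mul_add]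

theorem exists_bergman_multiplication {h : ℂ → ℂ} (hd : DifferentiableOn ℂ h (ball 0 1))
    (hb : ∀ z ∈ ball (0 : ℂ) 1, ‖h z‖ ≤ 1) :
    ∃ T : BergmanSpace →L[ℂ] BergmanSpace,
      ∀ (f : BergmanSpace) (g : ℂ → ℂ), IsHolomorphicRep (f : Lp ℂ 2 diskArea) g →
        IsHolomorphicRep (T f : Lp ℂ 2 diskArea) (h * g) := by
  obtain ⟨T, -, hT⟩ := exists_bergman_operator (LinearMap.mulLeft ℂ h) 1
    (fun g hg => hd.mul hg) fun g _ => by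
      rw [ENNReal.coe_one, one_mul]
      refine eLpNorm_mono_ae (ae_diskArea_of_forall_mem_ball fun z hz => ?_)
      rw [LinearMap.mulLeft_apply, Pi.mul_apply, norm_mul]
      exact mul_le_of_le_one_left (norm_nonneg _) (hb z hz)
  exact ⟨T, hT⟩

theorem exists_isHolomorphicRep_one :
    ∃ f : BergmanSpace, IsHolomorphicRep (f : Lp ℂ 2 diskArea) 1 := by
  have : IsFiniteMeasure diskArea := isFiniteMeasure_restrict.2 measure_ball_lt_top.ne
  have h : MemLp (1 : ℂ → ℂ) 2 diskArea := memLp_const 1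
  exact ⟨⟨h.toLp _, 1, differentiableOn_const 1, h.coeFn_toLp⟩, differentiableOn_const 1,
    h.coeFn_toLp⟩

theorem exp_mem_extendedSpectrum {a : ℂ} (ha : a.re = 0)
    {C : BergmanSpace →L[ℂ] BergmanSpace} (hC : IsCompositionOperator (parabolicMap a) C)
    {s : ℝ} (hs : 0 ≤ s) : Complex.exp (-s * a) ∈ extendedSpectrum C := by
  obtain ⟨X, hX⟩ := exists_bergman_multiplication (differentiableOn_singularInner s)
    fun _ => norm_singularInner_le_one hs
  refine ⟨X, ?_, ?_⟩
  · rintro rfl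
    obtain ⟨f, hf⟩ := exists_isHolomorphicRep_one
    have h0 : IsHolomorphicRep (0 : Lp ℂ 2 diskArea) 0 :=
      ⟨differentiableOn_const 0, Lp.coeFn_zero _ _ _⟩
    -- `X 1` is the singular inner function itself, with value `exp (-s) ≠ 0` at the origin.
    have h1 := (hX f 1 hf).eqOn h0 (mem_ball_self one_pos)
    simp [singularInner] at h1
  · ext1 f
    obtain ⟨g, hg⟩ := f.2
    refine ((hC _ _ (hX f g hg)).congr fun z hz => ?_).unique
      ((hX _ _ (hC f g hg)).const_smul (Complex.exp (-s * a)))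
    simp [singularInner_parabolicMap s ha hz, mul_assoc]

theorem exists_nonneg_exp_eq {a c : ℂ} (ha : a.re = 0) (ha0 : a ≠ 0) (hc : ‖c‖ = 1) :
    ∃ s : ℝ, 0 ≤ s ∧ Complex.exp (-s * a) = c := by
  obtain ⟨t, rfl⟩ : ∃ t : ℝ, a = t * Complex.I :=
    ⟨a.im, by apply Complex.ext <;> simp [ha]⟩
  have hc' : Complex.exp (c.arg * Complex.I) = c := by
    simpa [hc] using Complex.norm_mul_exp_arg_mul_I c
  have hlo := Complex.neg_pi_lt_arg c
  have hhi := Complex.arg_le_pi c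
  have hpi := Real.pi_pos
  have ht : t ≠ 0 := by
    rintro rfl
    simp at ha0
  -- The equation `-s t = arg c - 2πn` gives `s`; since `|arg c| ≤ π`, taking `n = ±1` with the sign
  -- of `t` makes `s` nonnegative.
  have main : ∀ n : ℤ, 0 ≤ (2 * Real.pi * n - c.arg) / t →
      ∃ s : ℝ, 0 ≤ s ∧ Complex.exp (-s * (t * Complex.I)) = c := by
    intro n hn
    refine ⟨_, hn, ?_⟩
    rw [← hc', Complex.exp_eq_exp_iff_exists_int]
    refine ⟨-n, ?_⟩
    have ht' : (t : ℂ) ≠ 0 := by exact_mod_cast ht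
    push_cast
    rw [hc']
    field_simp
    ring
  rcases lt_or_gt_of_ne ht with h | h
  · exact main (-1) (div_nonneg_of_nonpos (by push_cast; linarith) h.le)
  · exact main 1 (div_nonneg (by push_cast; linarith) h.le)

theorem theorem4p14 (a : ℂ) (ha : a.re = 0) (ha0 : a ≠ 0) :
    (∃! C : BergmanSpace →L[ℂ] BergmanSpace, IsCompositionOperator (parabolicMap a) C) ∧
      ∀ C : BergmanSpace →L[ℂ] BergmanSpace, IsCompositionOperator (parabolicMap a) C →
        extendedSpectrum C = Metric.sphere (0 : ℂ) 1 := by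
  obtain ⟨T, -, hT⟩ := exists_isCompositionOperator_parabolicMap ha
  refine ⟨⟨T, hT, fun C hC => hC.unique hT⟩, fun C hC => Set.ext fun c => ?_⟩
  rw [mem_sphere_zero_iff_norm]
  refine ⟨norm_eq_one_of_mem_extendedSpectrum (norm_nonneg a) (hC.exists_inverse_pow ha), fun hc => ?_⟩
  obtain ⟨s, hs, rfl⟩ := exists_nonneg_exp_eq ha ha0 hc
  exact exp_mem_extendedSpectrum ha hC hs
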